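/- Let $L\ge 0$ be an integer and let $X:[0,L]\to\mathbb{R}^2$ be a lattice path of length $L$: $X_0=0$, $X_k\in\mathbb{Z}^2$ for $k=0,\dots,L$, $\|X_{k+1}-X_k\|=1$, and $X$ is linear on each interval $[k,k+1]$. Let $w$ be the corresponding word, with $L$ letters drawn from a two letter alphabet $\{a_1,a_2\}$ and the inverse letters, whose $k$-th letter is $a_i^{\pm1}$ if the $k$-th step of $X$ is $\pm e_i$. Its $n$-th iterated integral is $$\mathbf{X}^n=\int_{0<u_1<\dots<u_n<L}dX_{u_1}\otimes\dots\otimes dX_{u_n}\in(\mathbb{R}^2)^{\otimes n},$$ and its $n$-th $GL(2,\mathbb{C})$-iterated integral is the image of $\mathbf{X}^n$ under the algebra homomorphism from the tensor algebra $T(\mathbb{R}^2)$ to the algebra of $2\times2$ complex matrices that extends the real-linear map $(x,y)\mapsto\begin{pmatrix}0&x+iy\\x-iy&0\end{pmatrix}$. Suppose that the $n$-th $GL(2,\mathbb{C})$-iterated integral of $X$ is zero for every $1\le n\le\lfloor e\log(1+\sqrt2)\,L\rfloor$. Then 1. $\mathbf{X}^n=0$ for every $n\ge1$; 2. $X$ is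 tree-like, that is, there is a continuous $h:[0,L]\to[0,\infty)$ with $h(0)=h(L)=0$ and $\|X_t-X_s\|\le h(s)+h(t)-2\inf_{u\in[s,t]}h(u)$ for all $0\le s\le t\le L$; 3. the reduced word of $w$, obtained by successively cancelling adjacent letters that are inverse to each other, is empty. -/

import Mathlib

noncomputable section

namespace LatticePath

/-- The Euclidean plane in which the integer lattice sits. -/
abbrev Plane : Type := EuclideanSpace ℝ (Fin 2)

/-- `X`, restricted to `[0, L]`, is a lattice path of length `L` in the two dimensional integer
lattice: it starts at the origin, visits lattice points at integer times, consecutive ones being at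
distance one, and is linear on each interval `[k, k + 1]`. -/
structure IsLatticePath (L : ℕ) (X : ℝ → Plane) : Prop where
  start : X 0 = 0
  lattice : ∀ k : ℕ, k ≤ L → ∀ i : Fin 2, ∃ m : ℤ, X k i = m
  unit_step : ∀ k : ℕ, k < L → ‖X (k + 1) - X k‖ = 1
  linear : ∀ k : ℕ, k < L → ∀ s : ℝ, 0 ≤ s → s ≤ 1 →
    X (k + s) = X k + s • (X (k + 1) - X k)

/-- The displacement of a letter: `(i, true)` is the letter `a_i` (one unit in direction `i`), and
`(i, false)` is its inverse. -/
def letterVec (a : Fin 2 × Bool) : Plane :=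
  EuclideanSpace.single a.1 (if a.2 then 1 else -1)

/-- The word `w` over two letters and their inverses, in the format used by `FreeGroup (Fin 2)`,
is the word of length `L` spelled by the successive steps of `X` on `[0, L]`. -/
def IsWordOf (w : List (Fin 2 × Bool)) (L : ℕ) (X : ℝ → Plane) : Prop :=
  w.length = L ∧ ∀ (k : ℕ) (hk : k < w.length), X (k + 1) - X k = letterVec w[k]

/-- Every lattice path spells a word. -/
theorem IsLatticePath.exists_isWordOf {L : ℕ} {X : ℝ → Plane} (hX : IsLatticePath L X) :
    ∃ w, IsWordOf w L X := by
  have key : ∀ k : Fin L, ∃ a, X ((k : ℕ) + 1) - X (k : ℕ) = letterVec a := by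
    intro k
    have h1 := hX.unit_step k k.2
    obtain ⟨p, hp⟩ := hX.lattice k k.2.le 0
    obtain ⟨q, hq⟩ := hX.lattice k k.2.le 1
    obtain ⟨r, hr⟩ := hX.lattice (k + 1) k.2 0
    obtain ⟨s, hs⟩ := hX.lattice (k + 1) k.2 1
    push_cast at hr hs
    have h2 : ((r - p : ℤ) : ℝ) ^ 2 + ((s - q : ℤ) : ℝ) ^ 2 = 1 := by
      have h3 := EuclideanSpace.real_norm_sq_eq (X ((k : ℕ) + 1) - X (k : ℕ))
      rw [h1, Fin.sum_univ_two] at h3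
      simp only [PiLp.sub_apply, hp, hq, hr, hs] at h3
      push_cast
      linarith
    have h4 : (r - p) ^ 2 + (s - q) ^ 2 = 1 := by exact_mod_cast h2
    have hv : X ((k : ℕ) + 1) - X (k : ℕ) = !₂[((r - p : ℤ) : ℝ), ((s - q : ℤ) : ℝ)] := by
      ext i
      fin_cases i <;> simp [hp, hq, hr, hs]
    rw [hv]
    generalize r - p = x at *
    generalize s - q = y at *
    have hx1 : x ≤ 1 := by nlinarith [sq_nonneg y]
    have hx2 : -1 ≤ x := by nlinarith [sq_nonneg y]
    have hy1 : y ≤ 1 := by nlinarith [sq_nonneg x]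
    have hy2 : -1 ≤ y := by nlinarith [sq_nonneg x]
    have hc : (x = 1 ∧ y = 0) ∨ (x = -1 ∧ y = 0) ∨ (x = 0 ∧ y = 1) ∨ (x = 0 ∧ y = -1) := by
      interval_cases x <;> interval_cases y <;> simp_all
    rcases hc with ⟨rfl, rfl⟩ | ⟨rfl, rfl⟩ | ⟨rfl, rfl⟩ | ⟨rfl, rfl⟩
    · exact ⟨(0, true), by ext i; fin_cases i <;> simp [letterVec]⟩
    · exact ⟨(0, false), by ext i; fin_cases i <;> simp [letterVec]⟩
    · exact ⟨(1, true), by ext i; fin_cases i <;> simp [letterVec]⟩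
    · exact ⟨(1, false), by ext i; fin_cases i <;> simp [letterVec]⟩
  choose f hf using key
  refine ⟨List.ofFn f, by simp, fun k hk => ?_⟩
  have hk' : k < L := by simpa using hk
  simpa using hf ⟨k, hk'⟩

/-- The coordinate iterated integral
`∫_{0 < u₁ < ⋯ < uₙ < t} dX^{I 1}_{u₁} ⋯ dX^{I n}_{uₙ}`, computed from the innermost variable `u₁`
to the outermost one `uₙ`. The paths considered are piecewise linear, so that `dX_u = X'(u) du`;
the finitely many times at which the derivative does not exist do not matter. -/
def coordIntegral (X : ℝ → Plane) : (n : ℕ) → (Fin n → Fin 2) → ℝ → ℝ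
  | 0, _, _ => 1
  | n + 1, I, t => ∫ u in (0 : ℝ)..t,
      coordIntegral X n (Fin.init I) u * deriv (fun s => X s (I (Fin.last n))) u

/-- The `n`-th iterated integral `∫_{0 < u₁ < ⋯ < uₙ < T} dX_{u₁} ⊗ ⋯ ⊗ dX_{uₙ}` of `X` over
`[0, T]`, that is the degree `n` term of its signature, as an element of the tensor algebra. -/
def iteratedIntegral (X : ℝ → Plane) (T : ℝ) (n : ℕ) : TensorAlgebra ℝ Plane :=
  ∑ I : Fin n → Fin 2, coordIntegral X n I T •
    TensorAlgebra.tprod ℝ Plane n (fun k => EuclideanSpace.single (I k) 1)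

/-- The embedding `(x, y) ↦ [[0, x + i y], [x - i y, 0]]` of the plane into the `2 × 2` complex
matrices. -/
def toMatrix : Plane →ₗ[ℝ] Matrix (Fin 2) (Fin 2) ℂ where
  toFun v := !![0, (v 0 : ℂ) + Complex.I * (v 1 : ℂ); (v 0 : ℂ) - Complex.I * (v 1 : ℂ), 0]
  map_add' v w := by
    ext i j
    fin_cases i <;> fin_cases j <;> simp <;> ring
  map_smul' c v := by
    ext i j
    fin_cases i <;> fin_cases j <;> simp <;> ring

/-- The `n`-th `GL(2, ℂ)`-iterated integral of `X` over `[0, T]`: the image of the `n`-th iterated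
integral under the algebra homomorphism from the tensor algebra to the `2 × 2` complex matrices
that extends the embedding of the plane. -/
def glIteratedIntegral (X : ℝ → Plane) (T : ℝ) (n : ℕ) : Matrix (Fin 2) (Fin 2) ℂ :=
  TensorAlgebra.lift ℝ toMatrix (iteratedIntegral X T n)

/-- The path `X` on `[0, T]` is tree-like: it has a nonnegative continuous height function. -/
def IsTreeLike (T : ℝ) (X : ℝ → Plane) : Prop :=
  ∃ h : ℝ → ℝ, ContinuousOn h (Set.Icc 0 T) ∧ (∀ t ∈ Set.Icc 0 T, 0 ≤ h t) ∧
    h 0 = 0 ∧ h T = 0 ∧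
    ∀ s t : ℝ, 0 ≤ s → s ≤ t → t ≤ T →
      ‖X t - X s‖ ≤ h s + h t - 2 * sInf (h '' Set.Icc s t)

end LatticePath

end

noncomputable section

namespace LatticePath

open Finset

/-! By Chen's identity the iterated integrals are the coefficients of the product of the formal
exponentials of the steps (`IsLatticePath.iteratedIntegral_eq_coeff`). Cancelling an inverse pair
does not change this product, and inserting one preserves tree-likeness (`HasHeight.insert`). So
everything follows once the reduced word is known to be empty.

For that, evaluate the image of the product in matrices at the scale θ = log(1 + √2), where cosh θ =
√2 and sinh θ = 1. The result P is a product of matrices `letterDev`. The n-th term of its series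
has norm at most (θL)^n / n!, and the terms of degree 1 to ⌊eθL⌋ vanish. What remains is 1 plus a
tail that Stirling's bound makes small, so ‖P - 1‖ < 1 (`norm_sub_one_lt_of_coeff_eq_zero`).

The first column of P has one entry in ℤ[i] and the other in √2 ℤ[i]. By this discreteness a column
so close to (1, 0) equals it (`wordDev_eq_of_norm_lt`). But P acts on the hyperbolic plane, and by
ping-pong a nonempty reduced word moves the base point into the half-plane of its first letter
(`wordDev_cons_of_isReduced`). Hence the reduced word is empty. -/

theorem prod_map_eq_of_red {α M : Type*} [Monoid M] {m : α × Bool → M}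
    (hm : ∀ i b, m (i, b) * m (i, !b) = 1) {w w' : List (α × Bool)} (h : FreeGroup.Red w w') :
    (w.map m).prod = (w'.map m).prod := by
  induction h with
  | refl => rfl
  | tail _ hs ih =>
    rw [ih]
    cases hs
    simp only [List.map_append, List.map_cons, List.prod_append, List.prod_cons]
    rw [← mul_assoc (m _) (m _), hm, one_mul]

/-- The binomial theorem in exponential form. It serves with (a, b) = (1, -1) to invert exponentials
and with (1, length) to bound coefficients. -/
theorem sum_antidiagonal_pow_div_factorial (a b : ℝ) (n : ℕ) :
    ∑ p ∈ antidiagonal n, a ^ p.1 / (p.1.factorial : ℝ) * (b ^ p.2 / (p.2.factorial : ℝ)) =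
      (a + b) ^ n / (n.factorial : ℝ) := by
  have h := congrArg (PowerSeries.coeff n) (PowerSeries.exp_mul_exp_eq_exp_add a b)
  simp only [PowerSeries.coeff_mul, PowerSeries.coeff_rescale, PowerSeries.coeff_exp, map_div₀,
    map_one, map_natCast, mul_one_div] at h
  exact h

/-! ### Formal exponentials of words in a real algebra -/

section WordSeries

variable {A B : Type*} [Ring A] [Algebra ℝ A] [Ring B] [Algebra ℝ B]

/-- The exponential of `v T` as a formal power series in the central variable `T`. -/
def expSeries (v : A) : PowerSeries A :=
  PowerSeries.mk fun n => (n.factorial : ℝ)⁻¹ • v ^ n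

theorem coeff_expSeries (v : A) (n : ℕ) :
    PowerSeries.coeff n (expSeries v) = (n.factorial : ℝ)⁻¹ • v ^ n :=
  PowerSeries.coeff_mk _ _

theorem expSeries_mul_expSeries_neg (v : A) : expSeries v * expSeries (-v) = 1 := by
  ext n
  rw [PowerSeries.coeff_mul, PowerSeries.coeff_one]
  have h : ∀ p ∈ antidiagonal n,
      PowerSeries.coeff p.1 (expSeries v) * PowerSeries.coeff p.2 (expSeries (-v)) =
        ((1 : ℝ) ^ p.1 / (p.1.factorial : ℝ) * ((-1) ^ p.2 / (p.2.factorial : ℝ))) • v ^ n := by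
    intro p hp
    have hn : (-v) ^ p.2 = ((-1 : ℝ) ^ p.2) • v ^ p.2 := by
      rw [← smul_pow, neg_one_smul]
    rw [coeff_expSeries, coeff_expSeries, hn, smul_mul_smul_comm, mul_smul_comm, smul_smul,
      ← pow_add, mem_antidiagonal.1 hp]
    congr 1
    rw [one_pow]
    ring
  rw [sum_congr rfl h, ← sum_smul, sum_antidiagonal_pow_div_factorial]
  rcases n with _ | n <;> simp

/-- The product of the exponentials of the letters of a word. -/
def wordSeries (m : Fin 2 × Bool → A) (w : List (Fin 2 × Bool)) : PowerSeries A :=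
  (w.map fun a => expSeries (m a)).prod

theorem map_wordSeries (f : A →ₐ[ℝ] B) (m : Fin 2 × Bool → A) (w : List (Fin 2 × Bool)) :
    PowerSeries.map (f : A →+* B) (wordSeries m w) = wordSeries (fun a => f (m a)) w := by
  rw [wordSeries, map_list_prod, List.map_map, wordSeries]
  congr 2
  ext a n
  simp [coeff_expSeries]

theorem wordSeries_eq_one_of_reduce_eq_nil {m : Fin 2 × Bool → A}
    (hm : ∀ i b, m (i, !b) = -m (i, b)) {w : List (Fin 2 × Bool)}
    (h : FreeGroup.reduce w = []) : wordSeries m w = 1 := by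
  have hr : FreeGroup.Red w (FreeGroup.reduce w) := FreeGroup.reduce.red
  rw [h] at hr
  rw [wordSeries, prod_map_eq_of_red (fun i b => ?_) hr]
  · simp
  · simp only [hm, expSeries_mul_expSeries_neg]

end WordSeries

theorem letterVec_not (i : Fin 2) (b : Bool) : letterVec (i, !b) = -letterVec (i, b) := by
  ext j
  cases b <;> by_cases h : j = i <;> simp [letterVec, h]

/-! ### Iterated integrals of a lattice path -/

section Integral

variable {L : ℕ} {X : ℝ → Plane}

/-- The coefficients of the polynomial in `s` that computes `coordIntegral X n I (k + s)`. -/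
def segCoeff (X : ℝ → Plane) (k : ℕ) : (n : ℕ) → (Fin n → Fin 2) → ℕ → ℝ
  | 0, _, 0 => 1
  | 0, _, _ + 1 => 0
  | n + 1, I, 0 => coordIntegral X (n + 1) I k
  | n + 1, I, j + 1 =>
      segCoeff X k n (Fin.init I) j * (X (k + 1) - X k) (I (Fin.last n)) / (j + 1)

theorem IsLatticePath.deriv_coord (hX : IsLatticePath L X) {k : ℕ} (hk : k < L) (i : Fin 2)
    {u : ℝ} (hu : u ∈ Set.Ioo (k : ℝ) (k + 1)) :
    deriv (fun s => X s i) u = (X (k + 1) - X k) i := by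
  have h : (fun s => X s i) =ᶠ[nhds u] fun s => X k i + (s - k) * (X (k + 1) - X k) i := by
    filter_upwards [Ioo_mem_nhds hu.1 hu.2] with s hs
    have := hX.linear k hk (s - k) (by linarith [hs.1]) (by linarith [hs.2])
    rw [add_sub_cancel] at this
    rw [this]
    simp
  rw [h.deriv_eq]
  have hd : HasDerivAt (fun s : ℝ => X k i + (s - k) * (X (k + 1) - X k) i)
      (1 * (X (k + 1) - X k) i) u :=
    (((hasDerivAt_id u).sub_const _).mul_const _).const_add _
  rw [hd.deriv, one_mul]

/-- On a segment `dX` is a constant times `du`, so by induction each integrand is a polynomial in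
the local time `s`. -/
theorem IsLatticePath.coordIntegral_eq_sum (hX : IsLatticePath L X) (n : ℕ) :
    ∀ (I : Fin n → Fin 2) (k : ℕ), k < L → ∀ s : ℝ, 0 ≤ s → s ≤ 1 →
      coordIntegral X n I (k + s) = ∑ j ∈ range (n + 1), segCoeff X k n I j * s ^ j := by
  induction n with
  | zero =>
    intro I k _ s _ _
    simp [coordIntegral, segCoeff]
  | succ n ih =>
    intro I
    set g : ℝ → ℝ := fun u =>
      coordIntegral X n (Fin.init I) u * deriv (fun s => X s (I (Fin.last n))) u with hg
    set q : ℕ → ℝ → ℝ := fun k r =>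
      (∑ j ∈ range (n + 1), segCoeff X k n (Fin.init I) j * r ^ j) *
        (X (k + 1) - X k) (I (Fin.last n)) with hq
    have hgq : ∀ k < L, ∀ u ∈ Set.Ioo (k : ℝ) (k + 1), g u = q k (u - k) := by
      intro k hk u hu
      have h := ih (Fin.init I) k hk (u - k) (by linarith [hu.1]) (by linarith [hu.2])
      rw [add_sub_cancel] at h
      simp only [hg, hq, hX.deriv_coord hk _ hu, h]
    have hqc : ∀ k, Continuous (q k) := fun k => by fun_prop
    have hae : ∀ k < L, ∀ s : ℝ, 0 ≤ s → s ≤ 1 →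
        ∀ᵐ u : ℝ, u ∈ Set.uIoc (k : ℝ) (k + s) → g u = q k (u - k) := by
      intro k hk s hs0 hs1
      -- The half-open interval already omits `k`; only the right endpoint, where `deriv` may take
      -- its default value, has to be discarded.
      have h1 : ∀ᵐ u : ℝ, u ≠ k + 1 := by simp [MeasureTheory.ae_iff]
      filter_upwards [h1] with u hu hmem
      rw [Set.uIoc_of_le (by linarith)] at hmem
      exact hgq k hk u ⟨hmem.1, lt_of_le_of_ne (by linarith [hmem.2]) hu⟩
    have hint : ∀ k < L, ∀ s : ℝ, 0 ≤ s → s ≤ 1 →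
        IntervalIntegrable g MeasureTheory.volume k (k + s) := by
      intro k hk s hs0 hs1
      have hc : Continuous fun u : ℝ => q k (u - k) := (hqc k).comp (by fun_prop)
      refine (hc.intervalIntegrable k (k + s)).congr_ae ?_
      rw [Filter.EventuallyEq, MeasureTheory.ae_restrict_iff' measurableSet_uIoc]
      filter_upwards [hae k hk s hs0 hs1] with u hu hmem using (hu hmem).symm
    intro k hk s hs0 hs1
    have h0k : IntervalIntegrable g MeasureTheory.volume 0 k := by
      have := IntervalIntegrable.trans_iterate (f := g) (μ := MeasureTheory.volume)
        (a := fun j : ℕ => (j : ℝ)) (n := k) (fun j hj => by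
          simpa using hint j (hj.trans hk) 1 zero_le_one le_rfl)
      simpa using this
    have hsplit : coordIntegral X (n + 1) I (k + s) =
        coordIntegral X (n + 1) I k + ∫ u in (k : ℝ)..(k + s), g u :=
      (intervalIntegral.integral_add_adjacent_intervals h0k (hint k hk s hs0 hs1)).symm
    have hval : ∫ u in (k : ℝ)..(k + s), g u =
        ∑ j ∈ range (n + 1), segCoeff X k (n + 1) I (j + 1) * s ^ (j + 1) := by
      rw [intervalIntegral.integral_congr_ae (hae k hk s hs0 hs1),
        intervalIntegral.integral_comp_sub_right (q k), sub_self, add_sub_cancel_left]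
      simp only [hq]
      rw [intervalIntegral.integral_mul_const, intervalIntegral.integral_finsetSum
        (fun j _ => Continuous.intervalIntegrable (by fun_prop) _ _), sum_mul]
      refine sum_congr rfl fun j _ => ?_
      rw [intervalIntegral.integral_const_mul, integral_pow, segCoeff]
      simp only [ne_eq, Nat.add_eq_zero_iff, one_ne_zero, and_false, not_false_eq_true, zero_pow,
        sub_zero]
      ring
    rw [hsplit, hval, sum_range_succ' _ (n + 1)]
    simp [segCoeff, add_comm]

theorem tprod_single_eq (n : ℕ) (I : Fin (n + 1) → Fin 2) :
    TensorAlgebra.tprod ℝ Plane (n + 1) (fun k => EuclideanSpace.single (I k) 1) =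
      TensorAlgebra.tprod ℝ Plane n (fun k => EuclideanSpace.single (Fin.init I k) 1) *
        TensorAlgebra.ι ℝ (EuclideanSpace.single (I (Fin.last n)) (1 : ℝ)) := by
  rw [TensorAlgebra.tprod_apply, TensorAlgebra.tprod_apply, List.ofFn_succ', List.concat_eq_append,
    List.prod_append, List.prod_singleton]
  rfl

theorem sum_smul_ι_single (v : Plane) :
    ∑ i, v i • TensorAlgebra.ι ℝ (EuclideanSpace.single i (1 : ℝ)) = TensorAlgebra.ι ℝ v := by
  simp_rw [← map_smul]
  rw [← map_sum]
  congr 1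
  ext j
  fin_cases j <;> simp

/-- Here `j` counts the integration variables lying in the current segment. They range over a
simplex, which gives 1/j!, and the other `n - j` variables give the integral up to time `k`. -/
theorem sum_segCoeff_smul_tprod (X : ℝ → Plane) (k n : ℕ) : ∀ j ≤ n,
    ∑ I : Fin n → Fin 2, segCoeff X k n I j •
      TensorAlgebra.tprod ℝ Plane n (fun k => EuclideanSpace.single (I k) 1) =
    iteratedIntegral X k (n - j) *
      ((j.factorial : ℝ)⁻¹ • TensorAlgebra.ι ℝ (X (k + 1) - X k) ^ j) := by
  induction n with
  | zero =>
    intro j hj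
    obtain rfl : j = 0 := by omega
    simp [segCoeff, iteratedIntegral, coordIntegral]
  | succ n ih =>
    intro j hj
    rcases j with _ | j
    · simp [segCoeff, iteratedIntegral]
    -- Splitting off the last index lets its sum reassemble the increment from its coordinates.
    · rw [← (Fin.snocEquiv fun _ => Fin 2).sum_comp, Fintype.sum_prod_type_right]
      have h : ∀ (J : Fin n → Fin 2) (i : Fin 2),
          segCoeff X k (n + 1) (Fin.snocEquiv (fun _ => Fin 2) (i, J)) (j + 1) •
            TensorAlgebra.tprod ℝ Plane (n + 1) (fun l => EuclideanSpace.single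
              (Fin.snocEquiv (fun _ => Fin 2) (i, J) l) 1) =
          ((j + 1 : ℝ)⁻¹ • (segCoeff X k n J j •
            TensorAlgebra.tprod ℝ Plane n (fun l => EuclideanSpace.single (J l) 1))) *
            ((X (k + 1) - X k) i • TensorAlgebra.ι ℝ (EuclideanSpace.single i (1 : ℝ))) := by
        intro J i
        rw [tprod_single_eq, segCoeff]
        simp only [Fin.snocEquiv, Equiv.coe_fn_mk, Fin.init_snoc, Fin.snoc_last]
        rw [smul_smul, smul_mul_smul_comm]
        congr 1
        ring
      simp_rw [h, ← mul_sum, sum_smul_ι_single, ← sum_mul, ← smul_sum]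
      rw [ih j (by omega), Nat.add_sub_add_right, pow_succ, Nat.factorial_succ]
      simp only [mul_smul_comm, smul_mul_assoc, smul_smul, mul_assoc]
      congr 1
      push_cast
      rw [mul_inv]

/-- Chen's identity for appending one segment: the polynomial in the local time is taken at `s = 1`.
-/
theorem IsLatticePath.iteratedIntegral_succ (hX : IsLatticePath L X) {k : ℕ} (hk : k < L)
    (n : ℕ) : iteratedIntegral X ((k + 1 : ℕ) : ℝ) n =
      ∑ p ∈ antidiagonal n, iteratedIntegral X k p.1 *
        PowerSeries.coeff p.2 (expSeries (TensorAlgebra.ι ℝ (X (k + 1) - X k))) := by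
  rw [iteratedIntegral]
  have h : ∀ I : Fin n → Fin 2, coordIntegral X n I ((k + 1 : ℕ) : ℝ) =
      ∑ j ∈ range (n + 1), segCoeff X k n I j := by
    intro I
    have := hX.coordIntegral_eq_sum n I k hk 1 zero_le_one le_rfl
    simpa using this
  simp_rw [h, sum_smul]
  rw [sum_comm, ← Nat.sum_antidiagonal_eq_sum_range_succ_mk
    (fun p : ℕ × ℕ => ∑ I : Fin n → Fin 2, segCoeff X k n I p.1 •
      TensorAlgebra.tprod ℝ Plane n (fun k => EuclideanSpace.single (I k) 1)),
    ← Finset.Nat.sum_antidiagonal_swap]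
  refine sum_congr rfl fun p hp => ?_
  have hp' := mem_antidiagonal.1 hp
  rw [coeff_expSeries, Prod.fst_swap, sum_segCoeff_smul_tprod X k n p.2 (by omega)]
  congr 3
  omega

theorem IsLatticePath.iteratedIntegral_eq_coeff (hX : IsLatticePath L X)
    {w : List (Fin 2 × Bool)} (hw : IsWordOf w L X) (n : ℕ) :
    iteratedIntegral X L n =
      PowerSeries.coeff n (wordSeries (fun a => TensorAlgebra.ι ℝ (letterVec a)) w) := by
  suffices h : ∀ k ≤ L, ∀ n, iteratedIntegral X k n = PowerSeries.coeff n
      (wordSeries (fun a => TensorAlgebra.ι ℝ (letterVec a)) (w.take k)) by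
    rw [h L le_rfl n, List.take_of_length_le hw.1.le]
  intro k
  induction k with
  | zero =>
    intro _ n
    rcases n with _ | n
    · simp [iteratedIntegral, coordIntegral, wordSeries]
    · simp [iteratedIntegral, coordIntegral, wordSeries, PowerSeries.coeff_one]
  | succ k ih =>
    intro hk n
    have hkw : k < w.length := by rw [hw.1]; omega
    rw [hX.iteratedIntegral_succ (by omega) n, ← List.take_concat_get hkw,
      List.concat_eq_append, wordSeries, List.map_append, List.prod_append, PowerSeries.coeff_mul]
    refine sum_congr rfl fun p _ => ?_
    rw [ih (by omega), hw.2 k hkw]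
    simp [wordSeries]

end Integral

/-! ### Tree-like paths -/

/-- The piecewise linear path spelled by a word. -/
def wordPath : List (Fin 2 × Bool) → ℝ → Plane
  | [], _ => 0
  | a :: w, t => max 0 (min 1 t) • letterVec a + wordPath w (t - 1)

theorem wordPath_of_nonpos (w : List (Fin 2 × Bool)) : ∀ t ≤ 0, wordPath w t = 0 := by
  induction w with
  | nil => intro t _; rfl
  | cons a w ih =>
    intro t ht
    rw [wordPath, ih _ (by linarith), max_eq_left (min_le_of_right_le ht)]
    simp

theorem wordPath_of_length_le (w : List (Fin 2 × Bool)) :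
    ∀ t, (w.length : ℝ) ≤ t → wordPath w t = wordPath w w.length := by
  induction w with
  | nil => intro t _; rfl
  | cons a w ih =>
    intro t ht
    have hl : (0 : ℝ) ≤ w.length := Nat.cast_nonneg _
    simp only [List.length_cons, Nat.cast_add, Nat.cast_one] at ht ⊢
    rw [wordPath, wordPath, ih _ (by linarith), add_sub_cancel_right,
      min_eq_left (by linarith), min_eq_left (by linarith)]

theorem wordPath_append (w₁ w₂ : List (Fin 2 × Bool)) :
    ∀ t, wordPath (w₁ ++ w₂) t = wordPath w₁ t + wordPath w₂ (t - w₁.length) := by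
  induction w₁ with
  | nil => intro t; simp [wordPath]
  | cons a w ih =>
    intro t
    simp only [List.cons_append, wordPath, ih, List.length_cons, Nat.cast_add, Nat.cast_one]
    rw [add_assoc, sub_sub, add_comm (1 : ℝ)]

theorem wordPath_add (w : List (Fin 2 × Bool)) : ∀ (k : ℕ) (hk : k < w.length) (s : ℝ),
    0 ≤ s → s ≤ 1 → wordPath w (k + s) = wordPath w k + s • letterVec w[k] := by
  induction w with
  | nil => intro k hk; simp at hk
  | cons a w ih =>
    intro k hk s hs0 hs1
    rcases k with _ | k
    · simp only [wordPath, Nat.cast_zero, zero_add, List.getElem_cons_zero]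
      rw [wordPath_of_nonpos w _ (by linarith), wordPath_of_nonpos w _ (by linarith),
        min_eq_right hs1, max_eq_right hs0]
      simp
    · have h0 : (0 : ℝ) ≤ k := Nat.cast_nonneg _
      have e : ((k + 1 : ℕ) : ℝ) + s - 1 = k + s := by push_cast; ring
      have e' : ((k + 1 : ℕ) : ℝ) - 1 = k := by push_cast; ring
      simp only [wordPath, List.getElem_cons_succ]
      rw [e, e', ih k (by simpa using hk) s hs0 hs1, min_eq_left (by push_cast; linarith),
        min_eq_left (by push_cast; linarith), add_assoc]

theorem IsLatticePath.eq_wordPath {L : ℕ} {X : ℝ → Plane} (hX : IsLatticePath L X)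
    {w : List (Fin 2 × Bool)} (hw : IsWordOf w L X) {t : ℝ} (ht : t ∈ Set.Icc (0 : ℝ) L) :
    X t = wordPath w t := by
  have hint : ∀ k : ℕ, k ≤ L → X k = wordPath w k := by
    intro k
    induction k with
    | zero =>
      intro _
      rw [Nat.cast_zero, hX.start, wordPath_of_nonpos w 0 le_rfl]
    | succ k ih =>
      intro hk
      have hkw : k < w.length := by rw [hw.1]; omega
      push_cast
      rw [wordPath_add w k hkw 1 zero_le_one le_rfl, one_smul, ← hw.2 k hkw, ← ih (by omega)]
      abel
  rcases ht.2.eq_or_lt with h | h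
  · rw [h, hint L le_rfl]
  · have hk : ⌊t⌋₊ < L := (Nat.floor_lt ht.1).2 h
    have hkw : ⌊t⌋₊ < w.length := by rw [hw.1]; omega
    have h1 := Nat.floor_le ht.1
    have h2 := Nat.lt_floor_add_one t
    have e : t = (⌊t⌋₊ : ℝ) + (t - ⌊t⌋₊) := by ring
    rw [e, hX.linear _ hk _ (by linarith) (by linarith),
      wordPath_add w _ hkw _ (by linarith) (by linarith), hw.2 _ hkw, hint _ hk.le]

/-- A form of tree-likeness in which the infimum of the height function over an interval is
replaced by one of its values there. -/
def HasHeight (T : ℝ) (X : ℝ → Plane) : Prop :=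
  ∃ h : ℝ → ℝ, Continuous h ∧ (∀ t, 0 ≤ h t) ∧ h 0 = 0 ∧ h T = 0 ∧
    ∀ s t : ℝ, 0 ≤ s → s ≤ t → t ≤ T →
      ∃ u ∈ Set.Icc s t, ‖X t - X s‖ ≤ h s + h t - 2 * h u

theorem HasHeight.isTreeLike {T : ℝ} {X Y : ℝ → Plane} (hY : HasHeight T Y)
    (hXY : ∀ t ∈ Set.Icc 0 T, X t = Y t) : IsTreeLike T X := by
  obtain ⟨h, hc, hpos, h0, hT, hh⟩ := hY
  refine ⟨h, hc.continuousOn, fun t _ => hpos t, h0, hT, fun s t hs hst ht => ?_⟩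
  obtain ⟨u, hu, hle⟩ := hh s t hs hst ht
  have hinf : sInf (h '' Set.Icc s t) ≤ h u :=
    csInf_le ⟨0, by rintro _ ⟨x, _, rfl⟩; exact hpos x⟩ ⟨u, hu, rfl⟩
  rw [hXY t ⟨hs.trans hst, ht⟩, hXY s ⟨hs, hst.trans ht⟩]
  linarith

/-- The path `t ↦ t` stopped during the time interval `[k, k + 2]`. -/
def pause (k t : ℝ) : ℝ := min t k + max (t - (k + 2)) 0

/-- The unit excursion above zero during the time interval `[k, k + 2]`. -/
def tent (k t : ℝ) : ℝ := max 0 (1 - |t - (k + 1)|)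

theorem pause_of_le {k t : ℝ} (h : t ≤ k) : pause k t = t := by
  rw [pause, min_eq_left h, max_eq_right (by linarith), add_zero]

theorem pause_of_mem {k t : ℝ} (h : k ≤ t) (h' : t ≤ k + 2) : pause k t = k := by
  rw [pause, min_eq_right h, max_eq_right (by linarith), add_zero]

theorem pause_of_ge {k t : ℝ} (h : k + 2 ≤ t) : pause k t = t - 2 := by
  rw [pause, min_eq_right (by linarith), max_eq_left (by linarith)]
  ring

theorem monotone_pause (k : ℝ) : Monotone (pause k) := fun s t h => by
  unfold pause
  gcongr

theorem tent_nonneg (k t : ℝ) : 0 ≤ tent k t := le_max_left _ _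

theorem tent_of_le {k t : ℝ} (h : t ≤ k) : tent k t = 0 := by
  rw [tent, abs_of_nonpos (by linarith)]
  exact max_eq_left (by linarith)

theorem tent_of_ge {k t : ℝ} (h : k + 2 ≤ t) : tent k t = 0 := by
  rw [tent, abs_of_nonneg (by linarith)]
  exact max_eq_left (by linarith)

theorem norm_letterVec (a : Fin 2 × Bool) : ‖letterVec a‖ = 1 := by
  obtain ⟨i, b⟩ := a
  cases b <;> simp [letterVec]

/-- Inserting a cancelling pair stops the old path for two units of time and adds a unit excursion
out and back. -/
theorem wordPath_insert (w₁ w₂ : List (Fin 2 × Bool)) (i : Fin 2) (b : Bool) (t : ℝ) :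
    wordPath (w₁ ++ (i, b) :: (i, !b) :: w₂) t =
      wordPath (w₁ ++ w₂) (pause w₁.length t) + tent w₁.length t • letterVec (i, b) := by
  set k : ℝ := (w₁.length : ℝ) with hk
  have hp : wordPath w₁ (pause k t) = wordPath w₁ t := by
    rcases le_total t k with h | h
    · rw [pause_of_le h]
    · rw [wordPath_of_length_le w₁ t h, wordPath_of_length_le w₁ (pause k t)]
      rw [← hk, ← pause_of_mem le_rfl (by linarith : k ≤ k + 2)]
      have := monotone_pause k h
      rwa [pause_of_mem le_rfl (by linarith : k ≤ k + 2)] at this ⊢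
  have hp2 : wordPath w₂ (pause k t - k) = wordPath w₂ (t - k - 1 - 1) := by
    rcases le_total t (k + 2) with h | h
    · have := monotone_pause k h
      rw [pause_of_mem (by linarith) le_rfl] at this
      rw [wordPath_of_nonpos w₂ _ (by linarith), wordPath_of_nonpos w₂ _ (by linarith)]
    · rw [pause_of_ge h]
      congr 1
      ring
  -- The ramps of the letter and of its inverse differ by one unit of time; their difference is the
  -- tent.
  have ht : tent k t = max 0 (min 1 (t - k)) - max 0 (min 1 (t - k - 1)) := by
    unfold tent
    rcases le_total t k with h1 | h1
    · rw [abs_of_nonpos (by linarith), max_eq_left (by linarith),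
        min_eq_right (by linarith), min_eq_right (by linarith), max_eq_left (by linarith),
        max_eq_left (by linarith), sub_zero]
    rcases le_total t (k + 1) with h2 | h2
    · rw [abs_of_nonpos (by linarith), max_eq_right (by linarith),
        min_eq_right (by linarith), min_eq_right (by linarith), max_eq_right (by linarith),
        max_eq_left (by linarith)]
      ring
    rcases le_total t (k + 2) with h3 | h3
    · rw [abs_of_nonneg (by linarith), max_eq_right (by linarith),
        min_eq_left (by linarith), min_eq_right (by linarith), max_eq_right (by linarith),
        max_eq_right (by linarith)]
      ring
    · rw [abs_of_nonneg (by linarith), max_eq_left (by linarith),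
        min_eq_left (by linarith), min_eq_left (by linarith), max_eq_right (by linarith), sub_self]
  rw [wordPath_append, wordPath_append, ← hk, hp, hp2, ht, wordPath, wordPath, letterVec_not,
    sub_smul, smul_neg]
  abel

theorem HasHeight.insert {w₁ w₂ : List (Fin 2 × Bool)} (i : Fin 2) (b : Bool)
    (H : HasHeight (w₁ ++ w₂).length (wordPath (w₁ ++ w₂))) :
    HasHeight (w₁ ++ (i, b) :: (i, !b) :: w₂).length
      (wordPath (w₁ ++ (i, b) :: (i, !b) :: w₂)) := by
  obtain ⟨h, hc, hpos, h0, hT, hh⟩ := H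
  set k : ℝ := (w₁.length : ℝ) with hk
  have hk0 : 0 ≤ k := Nat.cast_nonneg _
  have hl0 : (0 : ℝ) ≤ w₂.length := Nat.cast_nonneg _
  have hT' : ((w₁ ++ (i, b) :: (i, !b) :: w₂).length : ℝ) = k + w₂.length + 2 := by
    simp only [List.length_append, List.length_cons, hk]
    push_cast
    ring
  have hT2 : ((w₁ ++ w₂).length : ℝ) = k + w₂.length := by
    simp [hk]
  rw [hT']
  rw [hT2] at hT hh
  have hpT : pause k (k + w₂.length + 2) = k + w₂.length := by
    rw [pause_of_ge (by linarith)]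
    ring
  refine ⟨fun t => h (pause k t) + tent k t, ?_, fun t => add_nonneg (hpos _) (tent_nonneg _ _),
    ?_, ?_, ?_⟩
  · unfold pause tent
    fun_prop
  · simp [pause_of_le hk0, tent_of_le hk0, h0]
  · simp [hpT, hT, tent_of_ge (show k + 2 ≤ k + (w₂.length : ℝ) + 2 by linarith)]
  intro s t hs hst ht
  simp only [wordPath_insert, ← hk]
  have hv := norm_letterVec (i, b)
  set v := letterVec (i, b)
  set Y := wordPath (w₁ ++ w₂)
  have hs' : 0 ≤ pause k s := by
    have := monotone_pause k hs
    rwa [pause_of_le hk0] at this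
  have ht' : pause k t ≤ k + w₂.length := by
    have := monotone_pause k ht
    rwa [hpT] at this
  obtain ⟨u, hu, hle⟩ := hh _ _ hs' (monotone_pause k hst) ht'
  -- If the old witness lifts to a time in `[s, t]` at which the tent vanishes, the triangle
  -- inequality suffices, the excursion contributing at most `tent k s + tent k t`.
  have far : ∀ u' ∈ Set.Icc s t, pause k u' = u → tent k u' = 0 →
      ∃ u ∈ Set.Icc s t, ‖Y (pause k t) + tent k t • v - (Y (pause k s) + tent k s • v)‖ ≤
        h (pause k s) + tent k s + (h (pause k t) + tent k t) -
          2 * (h (pause k u) + tent k u) := by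
    intro u' hu' hpu htu
    refine ⟨u', hu', ?_⟩
    rw [hpu, htu]
    have e : Y (pause k t) + tent k t • v - (Y (pause k s) + tent k s • v) =
        (Y (pause k t) - Y (pause k s)) + (tent k t • v - tent k s • v) := by abel
    have n1 : ‖tent k t • v - tent k s • v‖ ≤ tent k t + tent k s := by
      refine (norm_sub_le _ _).trans ?_
      rw [norm_smul, norm_smul, hv, Real.norm_of_nonneg (tent_nonneg _ _),
        Real.norm_of_nonneg (tent_nonneg _ _), mul_one, mul_one]
    rw [e]
    linarith [norm_add_le (Y (pause k t) - Y (pause k s)) (tent k t • v - tent k s • v)]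
  -- Inside the excursion the path stays on one unit segment, so whichever of `s`, `t` has the lower
  -- tent is a witness.
  by_cases hnear : k ≤ s ∧ t ≤ k + 2
  · have hps := pause_of_mem hnear.1 (hst.trans hnear.2)
    have hpt := pause_of_mem (hnear.1.trans hst) hnear.2
    have e : Y (pause k t) + tent k t • v - (Y (pause k s) + tent k s • v) =
        (tent k t - tent k s) • v := by
      rw [hps, hpt, sub_smul]
      abel
    rw [e, norm_smul, hv, mul_one, Real.norm_eq_abs]
    rcases le_total (tent k s) (tent k t) with h1 | h1
    · refine ⟨s, ⟨le_rfl, hst⟩, ?_⟩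
      rw [abs_of_nonneg (by linarith), hps, hpt]
      linarith
    · refine ⟨t, ⟨hst, le_rfl⟩, ?_⟩
      rw [abs_of_nonpos (by linarith), hps, hpt]
      linarith
  -- The witness `u` lifts to `u` before the pause and to `u + 2` after it. For `u = k` both `k` and
  -- `k + 2` are lifts, and one of them lies in `[s, t]` because `[s, t]` is not contained in the
  -- pause.
  · rcases lt_trichotomy u k with huk | huk | huk
    · refine far u ⟨?_, ?_⟩ (pause_of_le huk.le) (tent_of_le huk.le)
      · by_contra hcon
        push Not at hcon
        have h1 := hu.1
        rcases le_total s k with h2 | h2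
        · rw [pause_of_le h2] at h1; linarith
        · have := monotone_pause k h2
          rw [pause_of_le le_rfl] at this
          linarith
      · have h2 := hu.2
        rcases le_total t k with h3 | h3
        · rwa [pause_of_le h3] at h2
        · linarith
    · rw [huk] at hu far
      have htu : k ≤ t := by
        by_contra hcon
        push Not at hcon
        have h2 := hu.2
        rw [pause_of_le hcon.le] at h2
        linarith
      have hsu : s ≤ k + 2 := by
        by_contra hcon
        push Not at hcon
        have h2 := hu.1
        rw [pause_of_ge hcon.le] at h2
        linarith
      by_cases hs2 : s ≤ k
      · exact far k ⟨hs2, htu⟩ (pause_of_le le_rfl) (tent_of_le le_rfl)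
      · refine far (k + 2) ⟨hsu, ?_⟩ (pause_of_mem (by linarith) le_rfl) (tent_of_ge le_rfl)
        by_contra hcon
        push Not at hcon hs2
        exact hnear ⟨hs2.le, hcon.le⟩
    · have htk : k + 2 ≤ t := by
        by_contra hcon
        push Not at hcon
        have h2 := (monotone_pause k hcon.le).trans_eq (pause_of_mem (by linarith) le_rfl)
        linarith [hu.2]
      refine far (u + 2) ⟨?_, ?_⟩ ?_ (tent_of_ge (by linarith))
      · rcases le_total s (k + 2) with h2 | h2
        · linarith
        · have := hu.1
          rw [pause_of_ge h2] at this
          linarith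
      · have := hu.2
        rw [pause_of_ge htk] at this
        linarith
      · rw [pause_of_ge (by linarith)]
        ring

theorem hasHeight_of_reduce_eq_nil {w : List (Fin 2 × Bool)} (h : FreeGroup.reduce w = []) :
    HasHeight w.length (wordPath w) := by
  have hr : FreeGroup.Red w (FreeGroup.reduce w) := FreeGroup.reduce.red
  rw [h] at hr
  -- The reduction is read backwards: starting from the empty word, each step inserts a cancelling
  -- pair.
  induction hr using Relation.ReflTransGen.head_induction_on with
  | refl =>
    exact ⟨fun _ => 0, continuous_const, fun _ => le_rfl, rfl, rfl,
      fun s t _ hst _ => ⟨s, ⟨le_rfl, hst⟩, by simp [wordPath]⟩⟩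
  | head hs _ ih =>
    cases hs
    refine HasHeight.insert _ _ (ih ?_)
    rw [← h]
    exact (FreeGroup.reduce.Step.eq FreeGroup.Red.Step.not).symm

/-! ### Tails of the exponential series -/

/-- Source of the factor e in the cutoff: Stirling gives m! ≥ √(2πm) (m/e)^m, where x < m/e and
√(2πm) ≥ 2. -/
theorem pow_div_factorial_le_half {x : ℝ} (hx : 0 ≤ x) {m : ℕ} (hm : Real.exp 1 * x < m) :
    x ^ m / (m.factorial : ℝ) ≤ 1 / 2 := by
  have he := Real.exp_pos 1
  have hm0 : (0 : ℝ) < m := lt_of_le_of_lt (by positivity) hm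
  have hm1 : (1 : ℝ) ≤ m := by exact_mod_cast (Nat.cast_pos.1 hm0)
  have hf := Stirling.le_factorial_stirling m
  have h2 : (2 : ℝ) ≤ √(2 * Real.pi * m) := by
    apply Real.le_sqrt_of_sq_le
    nlinarith [Real.pi_gt_three]
  have hxm : x ^ m ≤ (m / Real.exp 1) ^ m := by
    refine pow_le_pow_left₀ hx ?_ m
    rw [le_div_iff₀ he]
    linarith
  rw [div_le_iff₀ (by positivity)]
  have hpos : 0 ≤ (m / Real.exp 1) ^ m := by positivity
  nlinarith

/-- Past `m` the ratio of consecutive terms is below 1/e < 2/5. -/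
theorem pow_div_factorial_le_geometric {x : ℝ} (hx : 0 ≤ x) {m : ℕ} (hm : Real.exp 1 * x < m)
    (j : ℕ) : x ^ (m + j) / ((m + j).factorial : ℝ) ≤ 1 / 2 * (2 / 5) ^ j := by
  induction j with
  | zero => simpa using pow_div_factorial_le_half hx hm
  | succ j ih =>
    have he := Real.exp_one_gt_d9
    have hr : x / (m + j + 1) ≤ 2 / 5 := by
      have : (0 : ℝ) ≤ j := Nat.cast_nonneg _
      rw [div_le_iff₀ (by positivity)]
      nlinarith
    have e : x ^ (m + (j + 1)) / ((m + (j + 1)).factorial : ℝ) =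
        x ^ (m + j) / ((m + j).factorial : ℝ) * (x / (m + j + 1)) := by
      rw [← add_assoc, pow_succ, Nat.factorial_succ, div_mul_div_comm]
      push_cast
      ring
    rw [e, pow_succ, ← mul_assoc]
    exact mul_le_mul ih hr (by positivity) (by positivity)

/-! ### Summation of word series in a Banach algebra -/

section Norm

open Finset

variable {A : Type*} [NormedRing A] [NormedAlgebra ℝ A]

theorem norm_coeff_expSeries_le [NormOneClass A] {v : A} (hv : ‖v‖ ≤ 1) (n : ℕ) :
    ‖PowerSeries.coeff n (expSeries v)‖ ≤ 1 ^ n / (n.factorial : ℝ) := by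
  rw [coeff_expSeries, norm_smul, norm_inv, Real.norm_natCast, one_pow, one_div]
  exact mul_le_of_le_one_right (by positivity)
    ((norm_pow_le v n).trans (pow_le_one₀ (norm_nonneg _) hv))

theorem norm_coeff_wordSeries_le [NormOneClass A] {m : Fin 2 × Bool → A} (hm : ∀ a, ‖m a‖ ≤ 1)
    (w : List (Fin 2 × Bool)) (n : ℕ) :
    ‖PowerSeries.coeff n (wordSeries m w)‖ ≤ (w.length : ℝ) ^ n / (n.factorial : ℝ) := by
  induction w generalizing n with
  | nil => rcases n with _ | n <;> simp [wordSeries, PowerSeries.coeff_one]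
  | cons a w ih =>
    have e : wordSeries m (a :: w) = expSeries (m a) * wordSeries m w := by simp [wordSeries]
    rw [e, PowerSeries.coeff_mul, List.length_cons, Nat.cast_add, Nat.cast_one, add_comm,
      ← sum_antidiagonal_pow_div_factorial]
    refine (norm_sum_le _ _).trans (sum_le_sum fun p _ => (norm_mul_le _ _).trans ?_)
    exact mul_le_mul (norm_coeff_expSeries_le (hm a) _) (ih _) (norm_nonneg _) (by positivity)

theorem summable_norm_of_le {f : ℕ → A} {x θ : ℝ} (hθ : 0 ≤ θ)
    (hf : ∀ n, ‖f n‖ ≤ x ^ n / (n.factorial : ℝ)) : Summable fun n => ‖θ ^ n • f n‖ := by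
  refine Summable.of_nonneg_of_le (fun _ => norm_nonneg _) (fun n => ?_)
    (Real.summable_pow_div_factorial (θ * x))
  rw [norm_smul, norm_pow, Real.norm_of_nonneg hθ, mul_pow, mul_div_assoc]
  exact mul_le_mul_of_nonneg_left (hf n) (by positivity)

/-- Absolute convergence allows Cauchy products, so evaluation at `θ` is multiplicative over the
letters. -/
theorem hasSum_wordSeries [CompleteSpace A] [NormOneClass A] {m : Fin 2 × Bool → A} (hm : ∀ a, ‖m a‖ ≤ 1)
    {θ : ℝ} (hθ : 0 ≤ θ) {N : Fin 2 × Bool → A}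
    (hN : ∀ a, HasSum (fun n => θ ^ n • PowerSeries.coeff n (expSeries (m a))) (N a))
    (w : List (Fin 2 × Bool)) :
    HasSum (fun n => θ ^ n • PowerSeries.coeff n (wordSeries m w)) (w.map N).prod := by
  induction w with
  | nil =>
    have := hasSum_single (f := fun n => θ ^ n • PowerSeries.coeff n (wordSeries m [])) 0
      (fun n hn => by simp [wordSeries, PowerSeries.coeff_one, hn])
    simpa [wordSeries] using this
  | cons a w ih =>
    have e : wordSeries m (a :: w) = expSeries (m a) * wordSeries m w := by simp [wordSeries]
    have s1 := summable_norm_of_le hθ (norm_coeff_expSeries_le (hm a))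
    have s2 := summable_norm_of_le hθ (norm_coeff_wordSeries_le hm w)
    have e2 : ∀ n, θ ^ n • PowerSeries.coeff n (wordSeries m (a :: w)) =
        ∑ p ∈ antidiagonal n, (θ ^ p.1 • PowerSeries.coeff p.1 (expSeries (m a))) *
          (θ ^ p.2 • PowerSeries.coeff p.2 (wordSeries m w)) := by
      intro n
      rw [e, PowerSeries.coeff_mul, smul_sum]
      refine sum_congr rfl fun p hp => ?_
      rw [smul_mul_smul_comm, ← pow_add, mem_antidiagonal.1 hp]
    simp_rw [e2]
    rw [List.map_cons, List.prod_cons, ← (hN a).tsum_eq, ← ih.tsum_eq,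
      tsum_mul_tsum_eq_tsum_sum_antidiagonal_of_summable_norm s1 s2]
    exact (summable_norm_sum_mul_antidiagonal_of_summable_norm s1 s2).of_norm.hasSum

theorem hasSum_expSeries_of_sq_eq_one {v : A} (hv : v * v = 1) (θ : ℝ) :
    HasSum (fun n => θ ^ n • PowerSeries.coeff n (expSeries v))
      (Real.cosh θ • (1 : A) + Real.sinh θ • v) := by
  have hexp : ∀ x : ℝ, HasSum (fun n : ℕ => x ^ n / (n.factorial : ℝ)) (Real.exp x) := by
    intro x
    rw [Real.exp_eq_exp_ℝ]
    exact NormedSpace.expSeries_div_hasSum_exp x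
  have h1 := ((hexp θ).add (hexp (-θ))).div_const 2 |>.smul_const (1 : A)
  have h2 := ((hexp θ).sub (hexp (-θ))).div_const 2 |>.smul_const v
  rw [← Real.cosh_eq] at h1
  rw [← Real.sinh_eq] at h2
  convert h1.add h2 using 2 with n
  rw [coeff_expSeries, smul_smul]
  rcases n.even_or_odd' with ⟨k, rfl | rfl⟩
  · rw [pow_mul v, pow_two v, hv, one_pow, (even_two_mul k).neg_pow, sub_self, zero_div, zero_smul,
      add_zero]
    congr 1
    ring
  · rw [pow_succ v, pow_mul v, pow_two v, hv, one_pow, one_mul, (odd_two_mul_add_one k).neg_pow,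
      neg_div, add_neg_cancel, zero_div, zero_smul, zero_add]
    congr 1
    ring

theorem norm_sub_one_lt_of_coeff_eq_zero [NormOneClass A] {m : Fin 2 × Bool → A}
    (hm : ∀ a, ‖m a‖ ≤ 1) {θ : ℝ} (hθ : 0 ≤ θ) {w : List (Fin 2 × Bool)} {P : A}
    (hP : HasSum (fun n => θ ^ n • PowerSeries.coeff n (wordSeries m w)) P)
    (h0 : PowerSeries.coeff 0 (wordSeries m w) = 1)
    (hz : ∀ n : ℕ, 1 ≤ n → n ≤ ⌊Real.exp 1 * θ * (w.length : ℝ)⌋₊ →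
      PowerSeries.coeff n (wordSeries m w) = 0) : ‖P - 1‖ < 1 := by
  set M := ⌊Real.exp 1 * θ * (w.length : ℝ)⌋₊ + 1 with hM
  have hlt : Real.exp 1 * (θ * w.length) < M := by
    rw [← mul_assoc, hM]
    exact_mod_cast Nat.lt_floor_add_one _
  have hhead : ∑ n ∈ range M, θ ^ n • PowerSeries.coeff n (wordSeries m w) = 1 := by
    rw [hM, sum_range_succ', sum_eq_zero, h0]
    · simp
    · intro n hn
      rw [hz _ (by omega) (by have := mem_range.1 hn; omega), smul_zero]
  have htail := (hasSum_nat_add_iff' M).2 hP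
  rw [hhead] at htail
  have hgeo : HasSum (fun j : ℕ => (1 / 2 : ℝ) * (2 / 5) ^ j) (1 / 2 * (1 - 2 / 5)⁻¹) :=
    (hasSum_geometric_of_lt_one (by norm_num) (by norm_num)).mul_left _
  have hle := htail.norm_le_of_bounded hgeo (fun j => by
    refine le_trans ?_ (pow_div_factorial_le_geometric (by positivity) hlt j)
    rw [norm_smul, norm_pow, Real.norm_of_nonneg hθ, mul_pow, mul_div_assoc, add_comm j]
    exact mul_le_mul_of_nonneg_left (norm_coeff_wordSeries_le hm w _) (by positivity))
  -- The tail is at most (1/2) / (1 - 2/5) = 5/6.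
  exact hle.trans_lt (by norm_num)

end Norm

/-! ### The development of a lattice path at hyperbolic scale `log (1 + √2)` -/

/-- The unit complex number in the direction of a letter. -/
def letterDir (a : Fin 2 × Bool) : ℂ :=
  ⟨(letterVec a) 0, (letterVec a) 1⟩

theorem toMatrix_letterVec (a : Fin 2 × Bool) :
    toMatrix (letterVec a) = !![0, letterDir a; star (letterDir a), 0] := by
  ext i j
  fin_cases i <;> fin_cases j <;> apply Complex.ext <;> simp [toMatrix, letterDir]

theorem exists_int_letterDir (a : Fin 2 × Bool) :
    ∃ x y : ℤ, x ^ 2 + y ^ 2 = 1 ∧ letterDir a = ⟨x, y⟩ := by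
  obtain ⟨i, b⟩ := a
  fin_cases i <;> cases b
  · exact ⟨-1, 0, by norm_num, by simp [letterDir, letterVec]⟩
  · exact ⟨1, 0, by norm_num, by simp [letterDir, letterVec]⟩
  · exact ⟨0, -1, by norm_num, by simp [letterDir, letterVec]⟩
  · exact ⟨0, 1, by norm_num, by simp [letterDir, letterVec]⟩

theorem normSq_letterDir (a : Fin 2 × Bool) :
    (letterDir a).re ^ 2 + (letterDir a).im ^ 2 = 1 := by
  obtain ⟨x, y, h, e⟩ := exists_int_letterDir a
  rw [e]
  push_cast [← @Int.cast_inj ℝ] at h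
  exact h

/-- The hypothesis is the condition on adjacent letters of a reduced word. Two different such
letters have perpendicular directions, whence the Pythagorean identity. -/
theorem letterDir_eq_or_orthogonal {a b : Fin 2 × Bool} (h : a.1 = b.1 → a.2 = b.2) :
    letterDir a = letterDir b ∨
      ∀ z₁ z₂ : ℝ, ((letterDir a).re * z₁ + (letterDir a).im * z₂) ^ 2 +
        ((letterDir b).re * z₁ + (letterDir b).im * z₂) ^ 2 = z₁ ^ 2 + z₂ ^ 2 := by
  obtain ⟨i, p⟩ := a
  obtain ⟨j, q⟩ := b
  by_cases hij : i = j
  · left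
    have := h hij
    simp only at this
    rw [hij, this]
  · right
    intro z₁ z₂
    fin_cases i <;> fin_cases j <;> cases p <;> cases q <;>
      simp_all [letterDir, letterVec, add_comm]

/-- The development of a letter: the matrix `√2 + toMatrix (letterVec a)`, which is the exponential
of `log (1 + √2) • toMatrix (letterVec a)`. -/
def letterDev (a : Fin 2 × Bool) : Matrix (Fin 2) (Fin 2) ℂ :=
  !![(√2 : ℝ), letterDir a; star (letterDir a), (√2 : ℝ)]

theorem sq_toMatrix_letterVec (a : Fin 2 × Bool) :
    toMatrix (letterVec a) * toMatrix (letterVec a) = 1 := by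
  have h := normSq_letterDir a
  rw [toMatrix_letterVec]
  ext i j
  fin_cases i <;> fin_cases j <;> apply Complex.ext <;> simp <;> nlinarith

theorem letterDev_mul_letterDev_not (i : Fin 2) (b : Bool) :
    letterDev (i, b) * letterDev (i, !b) = 1 := by
  have h := normSq_letterDir (i, b)
  have h2 : √2 * √2 = 2 := Real.mul_self_sqrt (by norm_num)
  have e : letterDir (i, !b) = -letterDir (i, b) := by
    apply Complex.ext <;> simp [letterDir, letterVec_not]
  rw [letterDev, letterDev, e]
  ext p q
  fin_cases p <;> fin_cases q <;> apply Complex.ext <;> simp <;> nlinarith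

/-- The product of the developments of the letters of a word. -/
def wordDev (w : List (Fin 2 × Bool)) : Matrix (Fin 2) (Fin 2) ℂ :=
  (w.map letterDev).prod

theorem wordDev_reduce (w : List (Fin 2 × Bool)) : wordDev (FreeGroup.reduce w) = wordDev w :=
  (prod_map_eq_of_red letterDev_mul_letterDev_not FreeGroup.reduce.red).symm

theorem wordDev_nil : wordDev [] = 1 := rfl

theorem wordDev_cons_zero (a : Fin 2 × Bool) (w : List (Fin 2 × Bool)) :
    wordDev (a :: w) 0 0 = (√2 : ℝ) * wordDev w 0 0 + letterDir a * wordDev w 1 0 := by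
  simp [wordDev, letterDev, Matrix.mul_apply]

theorem wordDev_cons_one (a : Fin 2 × Bool) (w : List (Fin 2 × Bool)) :
    wordDev (a :: w) 1 0 = star (letterDir a) * wordDev w 0 0 + (√2 : ℝ) * wordDev w 1 0 := by
  simp [wordDev, letterDev, Matrix.mul_apply]

/-- Every `letterDev` lies in SU(1,1), which preserves the form |u|² - |v|². -/
theorem normSq_wordDev (w : List (Fin 2 × Bool)) :
    Complex.normSq (wordDev w 0 0) = Complex.normSq (wordDev w 1 0) + 1 := by
  induction w with
  | nil => simp [wordDev_nil]
  | cons a w ih =>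
    have h := normSq_letterDir a
    have h2 : √2 * √2 = 2 := Real.mul_self_sqrt (by norm_num)
    rw [wordDev_cons_zero, wordDev_cons_one]
    simp only [Complex.normSq_apply, Complex.add_re, Complex.add_im, Complex.mul_re,
      Complex.mul_im, Complex.star_def, Complex.conj_re, Complex.conj_im, Complex.ofReal_re,
      Complex.ofReal_im] at ih ⊢
    linear_combination ih + (wordDev w 0 0).re ^ 2 * (h2 - h) + (wordDev w 0 0).im ^ 2 * (h2 - h)
      - (wordDev w 1 0).re ^ 2 * (h2 - h) - (wordDev w 1 0).im ^ 2 * (h2 - h)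

/-! #### Integrality -/

/-- The diagonal entries of `letterDev` are √2 and the others Gaussian units, so each letter
exchanges the roles of ℤ[i] and √2 ℤ[i]. -/
theorem wordDev_integral (w : List (Fin 2 × Bool)) : ∃ p q r s : ℤ,
    (wordDev w 0 0 = ⟨p, q⟩ ∧ wordDev w 1 0 = ⟨√2 * r, √2 * s⟩) ∨
      (wordDev w 0 0 = ⟨√2 * p, √2 * q⟩ ∧ wordDev w 1 0 = ⟨r, s⟩) := by
  induction w with
  | nil =>
    refine ⟨1, 0, 0, 0, Or.inl ⟨?_, ?_⟩⟩ <;> apply Complex.ext <;> simp [wordDev_nil]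
  | cons a w ih =>
    obtain ⟨x, y, -, e⟩ := exists_int_letterDir a
    have h2 : √2 * √2 = 2 := Real.mul_self_sqrt (by norm_num)
    rw [wordDev_cons_zero, wordDev_cons_one, e]
    obtain ⟨p, q, r, s, ⟨hu, hv⟩ | ⟨hu, hv⟩⟩ := ih
    · refine ⟨p + (x * r - y * s), q + (x * s + y * r), x * p + y * q + 2 * r,
        x * q - y * p + 2 * s, Or.inr ⟨?_, ?_⟩⟩ <;> rw [hu, hv] <;> apply Complex.ext <;>
        simp <;> first | ring1 | linear_combination (r : ℝ) * h2 | linear_combination (s : ℝ) * h2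
    · refine ⟨2 * p + (x * r - y * s), 2 * q + (x * s + y * r), x * p + y * q + r,
        x * q - y * p + s, Or.inl ⟨?_, ?_⟩⟩ <;> rw [hu, hv] <;> apply Complex.ext <;>
        simp <;> first | ring1 | linear_combination (p : ℝ) * h2 | linear_combination (q : ℝ) * h2

theorem wordDev_eq_of_norm_lt {w : List (Fin 2 × Bool)} (hu : ‖wordDev w 0 0 - 1‖ < 1)
    (hv : ‖wordDev w 1 0‖ < 1) : wordDev w 0 0 = 1 ∧ wordDev w 1 0 = 0 := by
  have h2 : √2 * √2 = 2 := Real.mul_self_sqrt (by norm_num)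
  have hn := normSq_wordDev w
  have hu' : Complex.normSq (wordDev w 0 0 - 1) < 1 := by
    rw [Complex.normSq_eq_norm_sq]
    exact pow_lt_one₀ (norm_nonneg _) hu two_ne_zero
  have hv' : Complex.normSq (wordDev w 1 0) < 1 := by
    rw [Complex.normSq_eq_norm_sq]
    exact pow_lt_one₀ (norm_nonneg _) hv two_ne_zero
  obtain ⟨p, q, r, s, ⟨eu, ev⟩ | ⟨eu, ev⟩⟩ := wordDev_integral w
  · rw [eu] at hu'
    rw [ev] at hv'
    simp only [Complex.normSq_apply, Complex.sub_re, Complex.sub_im, Complex.one_re,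
      Complex.one_im, sub_zero] at hu' hv'
    have hv'' : ((2 * (r * r + s * s) : ℤ) : ℝ) < (1 : ℤ) := by
      push_cast
      linear_combination hv' - ((r : ℝ) * r + s * s) * h2
    have hu'' : (((p - 1) * (p - 1) + q * q : ℤ) : ℝ) < (1 : ℤ) := by
      push_cast
      exact hu'
    rw [Int.cast_lt] at hu'' hv''
    have hr : r = 0 := by nlinarith [mul_self_nonneg s, mul_self_nonneg r]
    have hs : s = 0 := by nlinarith [mul_self_nonneg s, mul_self_nonneg r]
    have hq : q = 0 := by nlinarith [mul_self_nonneg q, mul_self_nonneg (p - 1)]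
    have hp : p - 1 = 0 := by nlinarith [mul_self_nonneg q, mul_self_nonneg (p - 1)]
    obtain rfl : p = 1 := by omega
    subst hr hs hq
    rw [eu, ev]
    constructor <;> apply Complex.ext <;> simp
  · rw [eu, ev] at hn
    rw [ev] at hv'
    simp only [Complex.normSq_apply] at hn hv'
    have hv'' : ((r * r + s * s : ℤ) : ℝ) < (1 : ℤ) := by
      push_cast
      exact hv'
    have hn' : ((2 * (p * p + q * q) : ℤ) : ℝ) = ((r * r + s * s + 1 : ℤ) : ℝ) := by
      push_cast
      linear_combination hn - ((p : ℝ) * p + q * q) * h2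
    rw [Int.cast_lt] at hv''
    rw [Int.cast_inj] at hn'
    have h0 := mul_self_nonneg r
    have h1 := mul_self_nonneg s
    -- Parity: r² + s² < 1 forces r² + s² = 0, so 2(p² + q²) would be 1.
    omega

/-! #### Reduced words -/

/-- Half-planes of perpendicular letters are disjoint: T² < 2S² and T² = 1 + R² + S² give 2R² < T².
-/
theorem add_sqrt_two_mul_pos {T R S : ℝ} (hT : 0 < T) (hTRS : T ^ 2 = 1 + (R ^ 2 + S ^ 2))
    (hS : T < √2 * S) : 0 < T + √2 * R := by
  have h2 : √2 ^ 2 = 2 := Real.sq_sqrt (by norm_num)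
  have h1 : T ^ 2 < (√2 * S) ^ 2 := pow_lt_pow_left₀ hS hT.le two_ne_zero
  have h3 : (√2 * R) ^ 2 < T ^ 2 := by
    rw [mul_pow, h2] at h1 ⊢
    linarith
  have := (abs_lt_of_sq_lt_sq' h3 hT.le).1
  linarith

/-- Ping-pong. For a first column (u, v), put T = |u|² + |v|² and Z = 2u v̄; then T² = 1 + |Z|², so
(T, Z) is a point of the hyperboloid. The half-plane of a letter with direction c is T < √2⟨c, Z⟩.
The four half-planes are disjoint, and a letter maps the complement of the closed half-plane of its
inverse into its own half-plane. -/
theorem wordDev_cons_of_isReduced (a : Fin 2 × Bool) (w : List (Fin 2 × Bool))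
    (h : FreeGroup.IsReduced (a :: w)) :
    Complex.normSq (wordDev (a :: w) 0 0) + Complex.normSq (wordDev (a :: w) 1 0) <
      √2 * ((letterDir a).re * (2 * wordDev (a :: w) 0 0 * star (wordDev (a :: w) 1 0)).re +
        (letterDir a).im * (2 * wordDev (a :: w) 0 0 * star (wordDev (a :: w) 1 0)).im) := by
  -- The point of the remaining word is outside the closed half-plane of the inverse of `a`.
  have key : 0 < Complex.normSq (wordDev w 0 0) + Complex.normSq (wordDev w 1 0) +
      √2 * ((letterDir a).re * (2 * wordDev w 0 0 * star (wordDev w 1 0)).re +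
        (letterDir a).im * (2 * wordDev w 0 0 * star (wordDev w 1 0)).im) := by
    have hn := normSq_wordDev w
    have hT : 0 < Complex.normSq (wordDev w 0 0) + Complex.normSq (wordDev w 1 0) := by
      linarith [Complex.normSq_nonneg (wordDev w 1 0)]
    cases w with
    | nil => simp [wordDev_nil]
    | cons b w =>
      rw [FreeGroup.isReduced_cons_cons] at h
      have ih := wordDev_cons_of_isReduced b w h.2
      rcases letterDir_eq_or_orthogonal h.1 with e | e
      · rw [e]
        linarith
      · refine add_sqrt_two_mul_pos hT ?_ ih
        rw [e]
        generalize wordDev (b :: w) 0 0 = u at *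
        generalize wordDev (b :: w) 1 0 = v at *
        simp only [Complex.normSq_apply] at hn
        simp [Complex.normSq_apply]
        linear_combination (u.re * u.re + u.im * u.im - (v.re * v.re + v.im * v.im) + 1) * hn
  have hc := normSq_letterDir a
  have h2 : √2 ^ 2 = 2 := Real.sq_sqrt (by norm_num)
  rw [wordDev_cons_zero, wordDev_cons_one]
  generalize wordDev w 0 0 = u at *
  generalize wordDev w 1 0 = v at *
  generalize letterDir a = c at *
  obtain ⟨u₁, u₂⟩ := u
  obtain ⟨v₁, v₂⟩ := v
  obtain ⟨x, y⟩ := c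
  simp [Complex.normSq_apply] at key hc ⊢
  generalize √2 = k at *
  -- The new point has T' = 3T + 2√2⟨c, Z⟩ and ⟨c, Z'⟩ = 2√2 T + 3⟨c, Z⟩, so √2⟨c, Z'⟩ - T' = T +
  -- √2⟨c, Z⟩, the quantity in `key`.
  linear_combination key -
    ((u₁ ^ 2 + u₂ ^ 2 + v₁ ^ 2 + v₂ ^ 2) * (2 * (x ^ 2 + y ^ 2) - 1) +
      k * (2 * x * (u₁ * v₁ + u₂ * v₂) + 2 * y * (u₂ * v₁ - u₁ * v₂))) * h2 -
    (3 * (u₁ ^ 2 + u₂ ^ 2 + v₁ ^ 2 + v₂ ^ 2) +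
      k * (2 * x * (u₁ * v₁ + u₂ * v₂) + 2 * y * (u₂ * v₁ - u₁ * v₂))) * hc

theorem eq_nil_of_isReduced_of_wordDev {w : List (Fin 2 × Bool)} (h : FreeGroup.IsReduced w)
    (hu : wordDev w 0 0 = 1) (hv : wordDev w 1 0 = 0) : w = [] := by
  cases w with
  | nil => rfl
  | cons a w =>
    -- At the base point T = 1 and Z = 0, so this reads 1 < 0.
    have := wordDev_cons_of_isReduced a w h
    rw [hu, hv] at this
    norm_num at this

end LatticePath

/-! ### Small matrix series force an empty reduced word -/

section

attribute [local instance] Matrix.linftyOpNormedRing Matrix.linftyOpNormedAlgebra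

open LatticePath

/-- The norm is the maximal row sum: it is submultiplicative, dominates every entry, and each row
here has a single nonzero entry, of modulus one. -/
theorem LatticePath.norm_toMatrix_letterVec_le (a : Fin 2 × Bool) :
    ‖toMatrix (letterVec a)‖ ≤ 1 := by
  have h : ‖letterDir a‖ = 1 := by
    rw [Complex.norm_eq_sqrt_sq_add_sq, normSq_letterDir, Real.sqrt_one]
  have h' : ‖letterDir a‖₊ ≤ 1 := h.le
  rw [toMatrix_letterVec, Matrix.linfty_opNorm_def, ← NNReal.coe_one, NNReal.coe_le_coe]
  refine Finset.sup_le fun i _ => ?_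
  fin_cases i <;> simpa using h'

theorem LatticePath.norm_apply_le (P : Matrix (Fin 2) (Fin 2) ℂ) (i j : Fin 2) :
    ‖P i j‖ ≤ ‖P‖ := by
  rw [Matrix.linfty_opNorm_def, ← coe_nnnorm, NNReal.coe_le_coe]
  exact (Finset.single_le_sum (f := fun j => ‖P i j‖₊) (fun _ _ => zero_le)
    (Finset.mem_univ j)).trans (Finset.le_sup (f := fun i => ∑ j, ‖P i j‖₊) (Finset.mem_univ i))

theorem LatticePath.reduce_eq_nil {w : List (Fin 2 × Bool)}
    (hz : ∀ n : ℕ, 1 ≤ n → n ≤ ⌊Real.exp 1 * Real.log (1 + √2) * (w.length : ℝ)⌋₊ →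
      PowerSeries.coeff n (wordSeries (fun a => toMatrix (letterVec a)) w) = 0) :
    FreeGroup.reduce w = [] := by
  have h2 : √2 * √2 = 2 := Real.mul_self_sqrt (by norm_num)
  have hs : (1 : ℝ) ≤ √2 := Real.one_le_sqrt.2 (by norm_num)
  have hθ : 0 ≤ Real.log (1 + √2) := Real.log_nonneg (by linarith)
  have hinv : Real.exp (-Real.log (1 + √2)) = √2 - 1 := by
    rw [Real.exp_neg, Real.exp_log (by linarith)]
    exact inv_eq_of_mul_eq_one_right (by linarith)
  have hcosh : Real.cosh (Real.log (1 + √2)) = √2 := by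
    rw [Real.cosh_eq, hinv, Real.exp_log (by linarith)]
    ring
  have hsinh : Real.sinh (Real.log (1 + √2)) = 1 := by
    rw [Real.sinh_eq, hinv, Real.exp_log (by linarith)]
    ring
  have hN : ∀ a, HasSum (fun n => Real.log (1 + √2) ^ n •
      PowerSeries.coeff n (expSeries (toMatrix (letterVec a)))) (letterDev a) := by
    intro a
    have h := hasSum_expSeries_of_sq_eq_one (sq_toMatrix_letterVec a) (Real.log (1 + √2))
    rw [hcosh, hsinh] at h
    have e : letterDev a = √2 • (1 : Matrix (Fin 2) (Fin 2) ℂ) +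
        (1 : ℝ) • toMatrix (letterVec a) := by
      rw [toMatrix_letterVec, letterDev]
      ext i j
      fin_cases i <;> fin_cases j <;> simp
    rw [e]
    exact h
  have h0 : PowerSeries.coeff 0 (wordSeries (fun a => toMatrix (letterVec a)) w) = 1 := by
    rw [PowerSeries.coeff_zero_eq_constantCoeff, wordSeries, map_list_prod, List.map_map]
    apply List.prod_eq_one
    intro x hx
    obtain ⟨a, -, rfl⟩ := List.mem_map.1 hx
    simp [← PowerSeries.coeff_zero_eq_constantCoeff_apply, coeff_expSeries]
  have hlt : ‖wordDev w - 1‖ < 1 := norm_sub_one_lt_of_coeff_eq_zero norm_toMatrix_letterVec_le hθ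
    (hasSum_wordSeries norm_toMatrix_letterVec_le hθ hN w) h0 hz
  have hu := (norm_apply_le (wordDev w - 1) 0 0).trans_lt hlt
  have hv := (norm_apply_le (wordDev w - 1) 1 0).trans_lt hlt
  simp only [Matrix.sub_apply, Matrix.one_apply_eq, ne_eq, one_ne_zero, not_false_eq_true,
    Matrix.one_apply_ne, sub_zero] at hu hv
  obtain ⟨h00, h10⟩ := wordDev_eq_of_norm_lt hu hv
  rw [← wordDev_reduce] at h00 h10
  exact eq_nil_of_isReduced_of_wordDev (FreeGroup.isReduced_iff_reduce_eq.2
    FreeGroup.reduce.idem) h00 h10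

end

end

theorem mainTheorem6 (L : ℕ) (X : ℝ → LatticePath.Plane) (w : List (Fin 2 × Bool))
    (hX : LatticePath.IsLatticePath L X) (hw : LatticePath.IsWordOf w L X)
    (hzero : ∀ n : ℕ, 1 ≤ n → n ≤ ⌊Real.exp 1 * Real.log (1 + √2) * (L : ℝ)⌋₊ →
      LatticePath.glIteratedIntegral X L n = 0) :
    (∀ n : ℕ, 1 ≤ n → LatticePath.iteratedIntegral X L n = 0) ∧
    LatticePath.IsTreeLike L X ∧
    FreeGroup.reduce w = [] := by
  have hred : FreeGroup.reduce w = [] := by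
    apply LatticePath.reduce_eq_nil
    intro n hn1 hn2
    rw [hw.1] at hn2
    rw [← hzero n hn1 hn2, LatticePath.glIteratedIntegral, hX.iteratedIntegral_eq_coeff hw n]
    have h := congrArg (PowerSeries.coeff n) (LatticePath.map_wordSeries
      (TensorAlgebra.lift ℝ LatticePath.toMatrix)
      (fun a => TensorAlgebra.ι ℝ (LatticePath.letterVec a)) w)
    simp only [TensorAlgebra.lift_ι_apply, PowerSeries.coeff_map] at h
    exact h.symm
  refine ⟨fun n hn => ?_, ?_, hred⟩
  · rw [hX.iteratedIntegral_eq_coeff hw n,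
      LatticePath.wordSeries_eq_one_of_reduce_eq_nil (fun i b => ?_) hred, PowerSeries.coeff_one,
      if_neg (by omega)]
    rw [LatticePath.letterVec_not, map_neg]
  · have h := LatticePath.hasHeight_of_reduce_eq_nil hred
    rw [hw.1] at h
    exact h.isTreeLike fun t ht => hX.eq_wordPath hw ht
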